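/- Let $\mathcal K,\mathcal Z\subseteq\mathbb R^d$ be finite sets (arms and answers), $K=|\mathcal K|$, $\mathcal Z\neq\emptyset$, $\mathcal K$ spanning $\mathbb R^d$, let $\mathcal M\subseteq\mathbb R^d$, $\varepsilon\ge 0$ and $\delta\in(0,1)$. For $\lambda\in\mathbb R^d$ let $\mathcal Z_\varepsilon(\lambda)$ be either the set of additively $\varepsilon$-optimal answers $\{z\in\mathcal Z:\langle\lambda,z\rangle\ge\max_{z'\in\mathcal Z}\langle\lambda,z'\rangle-\varepsilon\}$, or the set of multiplicatively $\varepsilon$-optimal answers $\{z\in\mathcal Z:\langle\lambda,z\rangle\ge(1-\varepsilon)\max_{z'\in\mathcal Z}\langle\lambda,z'\rangle\}$; the result holds for both notions. Let $\neg_\varepsilon z$ be the closure of $\{\lambda\in\mathcal M: z\notin\mathcal Z_\varepsilon(\lambda)\}$. In each round $t\ge1$ an arm $a_t\in\mathcal K$ is chosen from the information $\mathcal F_{t-1}$ available after $t-1$ rounds ($\mathcal F_t$ is the history $\sigma(a_1,X_1,\dots,a_t,X_t)$, or a larger filtration if the rules are randomized), and $X_t=\langle\mu,a_t\rangle+\eta_t$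 is observed, where under $\mathbb P_\mu$ the noise $\eta_t\sim\mathcal N(0,1)$ is independent of $\mathcal F_{t-1}$. Put $N_t^a=\sum_{s\le t}\mathbf 1\{a_s=a\}$, $V_{N_t}=\sum_{a\in\mathcal K}N_t^a\,aa^{\top}$, $\|x\|_V^2=x^\top Vx$, and let $\mu_t=V_{N_t}^{-1}\sum_{s\le t}X_sa_s$ be the least squares estimator when $V_{N_t}$ is invertible. Define $$\beta(t,\delta)=2K\ln\bigl(4+\ln(t/K)\bigr)+K\,\mathcal C_G\!\left(\frac{\ln(1/\delta)}K\right),\qquad \mathcal C_G(x)=\min_{\lambda\in(1/2,1]}\frac{g_G(\lambda)+x}{\lambda},$$ where $g_G(\lambda)=2\lambda-2\lambda\ln(4\lambda)+\ln\zeta(2\lambda)-\tfrac12\ln(1-\lambda)$, $\zeta$ is the Riemann zeta function and $g_G(1)=+\infty$. Let $\mathcal T\subseteq\mathbb N$ be infinite. Take any sampling rule, and any $\mathcal F_t$-measurable candidates $z_t\in\mathcal Z$. Evaluate the GLR criterion $$\inf_{\lambda\in\neg_\varepsilon z_t}\|\mu_{t-1}-\lambda\|_{V_{N_{t-1}}}^2>2\beta(t-1,\delta)\qquad(\inf\emptyset=+\infty)$$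 at each $t\in\mathcal T$ with $t>K$ for which $V_{N_{t-1}}$ is invertible, and assume that at each such $t$ one has $z_t\in\mathcal Z_\varepsilon(\mu_{t-1})$ whenever $\mathcal Z_\varepsilon(\mu_{t-1})\ne\emptyset$ (this set is never empty for the additive notion). Let $\tau_\delta\in\mathbb N\cup\{+\infty\}$ be the first time at which the criterion is evaluated and holds, and let $\hat z=z_{\tau_\delta}$. Then the strategy is $(\varepsilon,\delta)$-PAC: $\tau_\delta$ is a stopping time, $\hat z$ is $\mathcal F_{\tau_\delta}$-measurable on $\{\tau_\delta<+\infty\}$, and for all $\mu\in\mathcal M$ $$\mathbb P_\mu\bigl[\tau_\delta<+\infty,\ \hat z\notin\mathcal Z_\varepsilon(\mu)\bigr]\le\delta .$$ -/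

import Mathlib

open MeasureTheory ProbabilityTheory Matrix

/-- The two notions of `ε`-optimality. -/
inductive OptNotion where
  | additive
  | multiplicative

/-- The value `max_{z ∈ 𝒵} ⟨μ, z⟩` of the best answer (a maximum, as `𝒵` is finite and non-empty). -/
noncomputable def bestValue {d : ℕ} (𝒵 : Finset (Fin d → ℝ)) (μ : Fin d → ℝ) : ℝ :=
  ⨆ z : 𝒵, μ ⬝ᵥ (z : Fin d → ℝ)

/-- The level that the value `⟨μ, z⟩` of an `ε`-optimal answer has to reach. -/
noncomputable def optLevel {d : ℕ} (𝒵 : Finset (Fin d → ℝ)) (ε : ℝ) :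
    OptNotion → (Fin d → ℝ) → ℝ
  | .additive, μ => bestValue 𝒵 μ - ε
  | .multiplicative, μ => (1 - ε) * bestValue 𝒵 μ

/-- The set of `ε`-optimal answers for the parameter `μ`. -/
def epsOptimal {d : ℕ} (o : OptNotion) (𝒵 : Finset (Fin d → ℝ)) (ε : ℝ) (μ : Fin d → ℝ) :
    Set 𝒵 :=
  {z | optLevel 𝒵 ε o μ ≤ μ ⬝ᵥ (z : Fin d → ℝ)}

/-- The alternative to the answer `z`: the closure of the set of the parameters in `ℳ` for which
`z` is not `ε`-optimal. -/
def alternative {d : ℕ} (o : OptNotion) (𝒵 : Finset (Fin d → ℝ)) (ℳ : Set (Fin d → ℝ)) (ε : ℝ)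
    (z : 𝒵) : Set (Fin d → ℝ) :=
  closure {lam | lam ∈ ℳ ∧ z ∉ epsOptimal o 𝒵 ε lam}

/-- The design matrix `V_w = ∑_{k ∈ 𝒦} w^k k kᵀ`. -/
noncomputable def designMatrix {d : ℕ} (𝒦 : Finset (Fin d → ℝ)) (w : 𝒦 → ℝ) :
    Matrix (Fin d) (Fin d) ℝ :=
  ∑ k : 𝒦, w k • vecMulVec (k : Fin d → ℝ) (k : Fin d → ℝ)

/-- The squared (semi-)norm `‖x‖_V² = xᵀ V x`. -/
def sqNorm {d : ℕ} (V : Matrix (Fin d) (Fin d) ℝ) (x : Fin d → ℝ) : ℝ :=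
  x ⬝ᵥ (V *ᵥ x)

section Statistics

variable {d : ℕ} {𝒦 : Finset (Fin d → ℝ)} {Ω : Type*}

open scoped Classical in
/-- The count `N_t^k` of the pulls of the arm `k` during the rounds `1, …, t`. -/
noncomputable def pullCount (a : ℕ → Ω → 𝒦) (t : ℕ) (ω : Ω) (k : 𝒦) : ℕ :=
  ((Finset.Icc 1 t).filter (fun s => a s ω = k)).card

/-- The design matrix `V_{N_t}` of the counts after `t` rounds. -/
noncomputable def empiricalDesign (a : ℕ → Ω → 𝒦) (t : ℕ) (ω : Ω) : Matrix (Fin d) (Fin d) ℝ :=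
  designMatrix 𝒦 (fun k => (pullCount a t ω k : ℝ))

/-- The ordinary least squares estimator `μ_t = V_{N_t}⁻¹ ∑_{s ≤ t} X_s a_s` after `t` rounds
(meaningful when `V_{N_t}` is invertible). -/
noncomputable def olsEstimator (a : ℕ → Ω → 𝒦) (X : ℕ → Ω → ℝ) (t : ℕ) (ω : Ω) : Fin d → ℝ :=
  (empiricalDesign a t ω)⁻¹ *ᵥ ∑ s ∈ Finset.Icc 1 t, X s ω • (a s ω : Fin d → ℝ)

end Statistics

/-- The function `g_G(λ) = 2λ - 2λ ln(4λ) + ln ζ(2λ) - ½ ln(1 - λ)` for `1/2 < λ < 1`. -/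
noncomputable def gGauss (lam : ℝ) : ℝ :=
  2 * lam - 2 * lam * Real.log (4 * lam) + Real.log (riemannZeta ((2 * lam : ℝ) : ℂ)).re
    - 1 / 2 * Real.log (1 - lam)

/-- The function `C_G(x) = min_{1/2 < λ ≤ 1} (g_G(λ) + x) / λ`. As `g_G(1) = +∞`, the value
`λ = 1` does not contribute to the minimum. -/
noncomputable def cGauss (x : ℝ) : ℝ :=
  sInf ((fun lam : ℝ => (gGauss lam + x) / lam) '' Set.Ioo (1 / 2) 1)

/-- The stopping threshold `β(t, δ) = 2 K ln(4 + ln(t / K)) + K C_G(ln(1/δ) / K)`. -/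
noncomputable def stopThreshold (K t : ℕ) (δ : ℝ) : ℝ :=
  2 * K * Real.log (4 + Real.log ((t : ℝ) / K)) + K * cGauss (Real.log (1 / δ) / K)

section Strategy

variable {d : ℕ} {𝒦 : Finset (Fin d → ℝ)} {𝒵 : Finset (Fin d → ℝ)}
  {Ω : Type*} {mΩ : MeasurableSpace Ω}

/-- `a` is a sampling rule and `X` the sequence of its observations, for the information flow `𝓖`:
the arm of the round `t + 1` is chosen from the information `𝓖 t` that is available after `t`
rounds, and the observation of the round `t + 1` is known after this round. The case of the
history `𝓖 t = σ(a_1, X_1, …, a_t, X_t)` is the one of rules without internal randomization; a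
larger filtration allows such a randomization. -/
structure IsSamplingRule (𝓖 : Filtration ℕ mΩ) (a : ℕ → Ω → 𝒦) (X : ℕ → Ω → ℝ) : Prop where
  arm_measurable : ∀ t, Measurable[𝓖 t] (a (t + 1))
  obs_measurable : ∀ t, Measurable[𝓖 (t + 1)] (X (t + 1))

/-- Under the probability measure `P`, the observations come from the linear Gaussian bandit with
parameter `μ`: in every round the observation is the mean `⟨μ, a⟩` of the chosen arm `a` plus a
standard Gaussian noise that is independent of the past. -/
structure IsGaussianBandit (𝓖 : Filtration ℕ mΩ) (a : ℕ → Ω → 𝒦) (X : ℕ → Ω → ℝ)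
    (μ : Fin d → ℝ) (P : Measure Ω) : Prop where
  isProbabilityMeasure : IsProbabilityMeasure P
  noise_law : ∀ t,
    P.map (fun ω => X (t + 1) ω - μ ⬝ᵥ (a (t + 1) ω : Fin d → ℝ)) = gaussianReal 0 1
  noise_indep : ∀ t,
    Indep (MeasurableSpace.comap (fun ω => X (t + 1) ω - μ ⬝ᵥ (a (t + 1) ω : Fin d → ℝ))
      inferInstance) (𝓖 t) P

/-- The stopping criterion is evaluated at round `t`: `t` belongs to the set `𝒯`, the first `K`
rounds are over, and the least squares estimator `μ_{t-1}` exists. -/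
def Evaluated (𝒯 : Set ℕ) (a : ℕ → Ω → 𝒦) (t : ℕ) (ω : Ω) : Prop :=
  t ∈ 𝒯 ∧ 𝒦.card < t ∧ IsUnit (empiricalDesign a (t - 1) ω).det

/-- The stopping criterion at round `t` for the candidate `z_t`:
`inf_{λ ∈ ¬_ε z_t} ‖μ_{t-1} - λ‖²_{V_{N_{t-1}}} > 2 β(t - 1, δ)`; the infimum over the empty set
is `+∞`. -/
def GLRCriterion (o : OptNotion) (ℳ : Set (Fin d → ℝ)) (ε δ : ℝ) (a : ℕ → Ω → 𝒦)
    (X : ℕ → Ω → ℝ) (z : ℕ → Ω → 𝒵) (t : ℕ) (ω : Ω) : Prop :=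
  ((2 * stopThreshold 𝒦.card (t - 1) δ : ℝ) : EReal) <
    ⨅ lam ∈ alternative o 𝒵 ℳ ε (z t ω),
      ((sqNorm (empiricalDesign a (t - 1) ω) (olsEstimator a X (t - 1) ω - lam) : ℝ) : EReal)

open scoped Classical in
/-- The first round at which the stopping criterion is evaluated and holds (`⊤` if there is
none). -/
noncomputable def glrStop (o : OptNotion) (ℳ : Set (Fin d → ℝ)) (ε δ : ℝ) (𝒯 : Set ℕ)
    (a : ℕ → Ω → 𝒦) (X : ℕ → Ω → ℝ) (z : ℕ → Ω → 𝒵) (ω : Ω) : WithTop ℕ :=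
  if h : ∃ t, Evaluated 𝒯 a t ω ∧ GLRCriterion o ℳ ε δ a X z t ω then
    ((Nat.find h : ℕ) : WithTop ℕ)
  else ⊤

/-- The answer `z_τ` recommended at the time `τ` (arbitrary when `τ = ⊤`). -/
def recommendedAt (z : ℕ → Ω → 𝒵) (τ : Ω → WithTop ℕ) (ω : Ω) : 𝒵 :=
  z ((τ ω).untopD 0) ω

/-- The stopping rule `τ` and the recommended answer `zhat` complete the sampling rule to an
`(ε, δ)`-PAC identification strategy: `τ` is a stopping time, `zhat` is known at the time `τ`, and
for every parameter `μ ∈ ℳ` the probability of stopping with an answer that is not `ε`-optimal is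
at most `δ`. -/
structure IsPACStrategy (o : OptNotion) (ℳ : Set (Fin d → ℝ)) (ε δ : ℝ) (𝓖 : Filtration ℕ mΩ)
    (P : (Fin d → ℝ) → Measure Ω) (τ : Ω → WithTop ℕ) (zhat : Ω → 𝒵) : Prop where
  isStoppingTime : IsStoppingTime 𝓖 τ
  measurable_answer : ∀ (z : 𝒵) (t : ℕ),
    MeasurableSet[𝓖 t] {ω | τ ω ≤ (t : WithTop ℕ) ∧ zhat ω = z}
  error_le : ∀ μ ∈ ℳ,
    P μ {ω | τ ω < ⊤ ∧ zhat ω ∉ epsOptimal o 𝒵 ε μ} ≤ ENNReal.ofReal δ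

end Strategy

/-! If the rule stops at `t` with an answer that is wrong for `μ`, then `μ` itself lies in the
alternative to that answer. The criterion then forces the squared norm of `μ_{t-1} - μ` above
`2β(t-1, δ)`. Completing the square arm by arm (`sqNorm_ols_sub_le`) bounds this norm by `∑
S_k²/N_k`, where `S_k` is the sum of the noise on arm `k` and `N_k` its count. It remains to show
that, with probability at least `1 - δ`, half of this sum never exceeds `β(t, δ)` at any `t ≥ K`.

For this, fix `L` in `(1/2, 1)`. The likelihood ratio of a centred Gaussian prior on a shift of the
noise mean is a martingale. So is a countable mixture of such ratios for one arm, and so is the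
product of these mixtures over the arms (`setLIntegral_mixWealth_succ`), since each round changes
only one factor. The product starts at `1`, and Ville's inequality bounds the probability that it
ever reaches `1/δ` by `δ`.

The priors are tuned to the geometric slices `e^{4i} ≤ n < e^{4(i+1)}` of the count `n`. Keeping
only the prior of the current slice shows that the mixture of one arm is at least `exp (L (S²/(2n) -
2 ln(4 + ln n)) - g_G(L))` (`exp_le_mixRatio`). In the product these exponents add up, and concavity
of `ln(4 + ln n)` replaces the counts by their mean `t/K` (`sum_sliceCost_le`). This gives the
threshold with `(g_G(L) + x)/L` in place of `C_G(x)`; the infimum over `L` is reached by a limit of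
events. -/

/-- The precision of the `i`-th centred Gaussian prior of the mixture. -/
noncomputable def mixPrecision (L : ℝ) (i : ℕ) : ℝ :=
  Real.exp (4 * i) * ((1 - L) / L)

/-- The weight of the `i`-th prior of the mixture. -/
noncomputable def mixWeight (L : ℝ) (i : ℕ) : ℝ :=
  (((i : ℝ) + 1) ^ (2 * L))⁻¹ / (riemannZeta ((2 * L : ℝ) : ℂ)).re

/-- The value, after `n` observations with noise sum `S`, of the likelihood ratio of the Gaussian
prior with precision `κ`. -/
noncomputable def gaussRatio (κ v S : ℝ) : ℝ :=
  √(κ / (v + κ)) * Real.exp (S ^ 2 / (2 * (v + κ)))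

/-- The mixture of the Gaussian likelihood ratios. -/
noncomputable def mixRatio (L : ℝ) (n : ℕ) (S : ℝ) : ENNReal :=
  ∑' i, ENNReal.ofReal (mixWeight L i * gaussRatio (mixPrecision L i) n S)

/-- The price `ln (4 + ln n)` of uniformity over the number `n` of observations, continued to
`n = 0`. -/
noncomputable def sliceCost (n : ℕ) : ℝ :=
  if n = 0 then 1 else Real.log (4 + Real.log n)

/-! ### The one-arm mixture: normalization and martingale property. -/

lemma mixPrecision_pos {L : ℝ} (hL : L ∈ Set.Ioo (1 / 2 : ℝ) 1) (i : ℕ) :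
    0 < mixPrecision L i := by
  have h0 : 0 < L := by linarith [hL.1]
  have h1 : 0 < 1 - L := by linarith [hL.2]
  unfold mixPrecision; positivity

lemma hasSum_zeta_re {p : ℝ} (hp : 1 < p) :
    HasSum (fun i : ℕ => (((i : ℝ) + 1) ^ p)⁻¹) (riemannZeta (p : ℂ)).re := by
  have hs : Summable (fun i : ℕ => (((i : ℝ) + 1) ^ p)⁻¹) := by
    have := (summable_nat_add_iff 1).2 (Real.summable_nat_rpow_inv.2 hp)
    simpa using this
  have hz : riemannZeta (p : ℂ) = ((∑' i : ℕ, (((i : ℝ) + 1) ^ p)⁻¹ : ℝ) : ℂ) := by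
    rw [zeta_eq_tsum_one_div_nat_add_one_cpow (by simpa using hp), Complex.ofReal_tsum]
    refine tsum_congr fun i => ?_
    rw [Complex.ofReal_inv, Complex.ofReal_cpow (by positivity)]
    push_cast
    rw [one_div]
  rw [hz, Complex.ofReal_re]
  exact hs.hasSum

lemma one_le_zeta_re {p : ℝ} (hp : 1 < p) : 1 ≤ (riemannZeta (p : ℂ)).re := by
  have h := hasSum_zeta_re hp
  have := h.summable.le_tsum 0 (fun i _ => by positivity)
  rw [h.tsum_eq] at this
  simpa using this

lemma mixWeight_nonneg {L : ℝ} (hL : L ∈ Set.Ioo (1 / 2 : ℝ) 1) (i : ℕ) : 0 ≤ mixWeight L i := by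
  have := one_le_zeta_re (p := 2 * L) (by linarith [hL.1])
  unfold mixWeight
  positivity

lemma tsum_mixWeight {L : ℝ} (hL : L ∈ Set.Ioo (1 / 2 : ℝ) 1) :
    ∑' i, ENNReal.ofReal (mixWeight L i) = 1 := by
  have h1 := one_le_zeta_re (p := 2 * L) (by linarith [hL.1])
  have h := (hasSum_zeta_re (p := 2 * L) (by linarith [hL.1])).div_const
    (riemannZeta ((2 * L : ℝ) : ℂ)).re
  rw [div_self (by linarith)] at h
  rw [← ENNReal.ofReal_tsum_of_nonneg (mixWeight_nonneg hL) h.summable]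
  unfold mixWeight
  rw [h.tsum_eq, ENNReal.ofReal_one]

lemma mixRatio_zero_zero {L : ℝ} (hL : L ∈ Set.Ioo (1 / 2 : ℝ) 1) : mixRatio L 0 0 = 1 := by
  rw [← tsum_mixWeight hL]
  refine tsum_congr fun i => ?_
  have := mixPrecision_pos hL i
  simp [gaussRatio, div_self this.ne']

lemma measurable_mixRatio (L : ℝ) : Measurable (fun q : ℕ × ℝ => mixRatio L q.1 q.2) := by
  unfold mixRatio gaussRatio
  fun_prop

/-- `gaussRatio κ v S` is the integral of `exp (θS - θ²v/2)` over `θ ∼ N(0, 1/κ)`, so a fresh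
standard Gaussian term preserves it in mean. -/
lemma lintegral_gaussRatio {κ v : ℝ} (hκ : 0 < κ) (hv : 0 ≤ v) (S : ℝ) :
    ∫⁻ x, ENNReal.ofReal (gaussRatio κ (v + 1) (S + x)) ∂(gaussianReal 0 1)
      = ENNReal.ofReal (gaussRatio κ v S) := by
  have hu : 0 < v + κ := by positivity
  set u := v + κ with hu_def
  have hσ : 0 < (u + 1) / u := by positivity
  set σ : NNReal := ⟨(u + 1) / u, hσ.le⟩ with hσ_def
  have hσ' : (σ : ℝ) = (u + 1) / u := rfl
  have hσ0 : σ ≠ 0 := by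
    intro h
    rw [h] at hσ'
    simp only [NNReal.coe_zero] at hσ'
    linarith
  -- Bayes' rule: the new term has predictive law `N(S/u, (u+1)/u)`, whose density integrates to
  -- `1`.
  have key : ∀ x, gaussianPDFReal 0 1 x * gaussRatio κ (v + 1) (S + x)
      = gaussRatio κ v S * gaussianPDFReal (S / u) σ x := by
    intro x
    unfold gaussianPDFReal gaussRatio
    rw [show v + 1 + κ = u + 1 by ring, ← hu_def, hσ']
    have e1 : Real.exp (-(x - 0) ^ 2 / (2 * ((1 : NNReal) : ℝ))) *
        Real.exp ((S + x) ^ 2 / (2 * (u + 1)))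
        = Real.exp (S ^ 2 / (2 * u)) * Real.exp (-(x - S / u) ^ 2 / (2 * ((u + 1) / u))) := by
      rw [← Real.exp_add, ← Real.exp_add]
      congr 1
      push_cast
      field_simp
      ring
    have e2 : (√(2 * Real.pi * ((1 : NNReal) : ℝ)))⁻¹ * √(κ / (u + 1))
        = √(κ / u) * (√(2 * Real.pi * ((u + 1) / u)))⁻¹ := by
      have hpi := Real.pi_pos
      rw [← Real.sqrt_inv, ← Real.sqrt_inv, ← Real.sqrt_mul (by positivity),
        ← Real.sqrt_mul (by positivity)]
      congr 1
      push_cast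
      field_simp
    calc _ = ((√(2 * Real.pi * ((1 : NNReal) : ℝ)))⁻¹ * √(κ / (u + 1))) *
          (Real.exp (-(x - 0) ^ 2 / (2 * ((1 : NNReal) : ℝ))) *
        Real.exp ((S + x) ^ 2 / (2 * (u + 1)))) := by ring
      _ = _ := by rw [e1, e2]; ring
  have h0 : 0 ≤ gaussRatio κ v S := by unfold gaussRatio; positivity
  have hmeas : Measurable (fun x => ENNReal.ofReal (gaussRatio κ (v + 1) (S + x))) := by
    unfold gaussRatio; fun_prop
  rw [gaussianReal_of_var_ne_zero 0 one_ne_zero,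
    lintegral_withDensity_eq_lintegral_mul _ (measurable_gaussianPDF 0 1) hmeas]
  calc _ = ∫⁻ x, ENNReal.ofReal (gaussRatio κ v S) * gaussianPDF (S / u) σ x := by
        refine lintegral_congr fun x => ?_
        simp only [Pi.mul_apply, gaussianPDF]
        rw [← ENNReal.ofReal_mul (gaussianPDFReal_nonneg _ _ _), ← ENNReal.ofReal_mul h0, key]
    _ = _ := by
        rw [lintegral_const_mul _ (measurable_gaussianPDF _ _),
          lintegral_gaussianPDF_eq_one _ hσ0, mul_one]

lemma lintegral_mixRatio {L : ℝ} (hL : L ∈ Set.Ioo (1 / 2 : ℝ) 1) (n : ℕ) (S : ℝ) :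
    ∫⁻ x, mixRatio L (n + 1) (S + x) ∂(gaussianReal 0 1) = mixRatio L n S := by
  unfold mixRatio
  rw [lintegral_tsum]
  · refine tsum_congr fun i => ?_
    have hw := mixWeight_nonneg hL i
    simp_rw [ENNReal.ofReal_mul hw]
    rw [lintegral_const_mul]
    · push_cast
      rw [lintegral_gaussRatio (mixPrecision_pos hL i) n.cast_nonneg]
    · unfold gaussRatio; fun_prop
  · intro i
    unfold gaussRatio
    fun_prop

/-! ### Lower bounds on the one-arm mixture, and concavity of the slice cost. -/

/-- The right side minus the left is concave in `L` on `[1/2, 1]`, zero at `1` and non-negative at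
`1/2`. The bound turns the loss across a slice of ratio `e⁴` into the terms `2L - 2L ln L` of `g_G`.
-/
lemma log_add_mul_exp_four_le {L : ℝ} (hL : L ∈ Set.Ioo (1 / 2 : ℝ) 1) :
    Real.log (1 + L * (Real.exp 4 - 1)) ≤ 4 * L - 4 * (L * Real.log L) := by
  set m : ℝ := Real.exp 4 - 1 with hm
  have hexp2 : 7.38 < Real.exp 2 ∧ Real.exp 2 < 7.4 := by
    have h1 := Real.exp_one_gt_d9
    have h2 := Real.exp_one_lt_d9
    have : Real.exp 2 = Real.exp 1 * Real.exp 1 := by rw [← Real.exp_add]; norm_num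
    rw [this]
    constructor <;> nlinarith
  have hexp4 : Real.exp 4 = Real.exp 2 * Real.exp 2 := by rw [← Real.exp_add]; norm_num
  have hm0 : 0 < m := by rw [hm, hexp4]; nlinarith [hexp2.1]
  set f : ℝ → ℝ := fun x => 4 * x - 4 * (x * Real.log x) - Real.log (1 + x * m) with hf
  set f' : ℝ → ℝ := fun x => - 4 * Real.log x - m / (1 + x * m) with hf'
  set f'' : ℝ → ℝ := fun x => - 4 / x + m ^ 2 / (1 + x * m) ^ 2 with hf''
  have hpos : ∀ x ∈ Set.Icc (1 / 2 : ℝ) 1, 0 < x ∧ 0 < 1 + x * m := fun x hx => by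
    have : 0 < x := by linarith [hx.1]
    exact ⟨this, by positivity⟩
  have hd : ∀ x ∈ Set.Icc (1 / 2 : ℝ) 1, HasDerivAt f (f' x) x := by
    intro x hx
    obtain ⟨h1, h2⟩ := hpos x hx
    have d1 : HasDerivAt (fun x : ℝ => 4 * x) 4 x := by simpa using (hasDerivAt_id x).const_mul 4
    have d2 := (Real.hasDerivAt_mul_log h1.ne').const_mul 4
    have d3 : HasDerivAt (fun x : ℝ => 1 + x * m) m x := by
      simpa using ((hasDerivAt_id x).mul_const m).const_add 1
    refine ((d1.sub d2).sub (d3.log h2.ne')).congr_deriv ?_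
    simp only [hf']
    ring
  have hd2 : ∀ x ∈ Set.Icc (1 / 2 : ℝ) 1, HasDerivAt f' (f'' x) x := by
    intro x hx
    obtain ⟨h1, h2⟩ := hpos x hx
    have d2 := (Real.hasDerivAt_log h1.ne').const_mul (-4)
    have d3 : HasDerivAt (fun x : ℝ => 1 + x * m) m x := by
      simpa using ((hasDerivAt_id x).mul_const m).const_add 1
    refine (d2.sub ((hasDerivAt_const x m).div d3 h2.ne')).congr_deriv ?_
    simp only [hf'']
    field_simp
    ring
  have hconc : ConcaveOn ℝ (Set.Icc (1 / 2 : ℝ) 1) f := by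
    refine concaveOn_of_hasDerivWithinAt2_nonpos (f' := f') (f'' := f'') (convex_Icc _ _)
      (fun x hx => (hd x hx).continuousAt.continuousWithinAt)
      (fun x hx => (hd x (interior_subset hx)).hasDerivWithinAt)
      (fun x hx => (hd2 x (interior_subset hx)).hasDerivWithinAt) ?_
    intro x hx
    have hx := interior_subset hx
    obtain ⟨h1, h2⟩ := hpos x hx
    have : m ^ 2 / (1 + x * m) ^ 2 ≤ 4 / x := by
      rw [div_le_div_iff₀ (by positivity) h1]
      have : x * m ^ 2 ≤ 4 * (x * m) ^ 2 := by nlinarith [hx.1, mul_pos h1 (pow_pos hm0 2)]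
      nlinarith [mul_pos h1 hm0]
    simp only [hf'']
    rw [neg_div]
    linarith
  have hf1 : f 1 = 0 := by
    simp only [hf, hm]
    norm_num [Real.log_one]
  have hf2 : 0 ≤ f (1 / 2) := by
    -- At `L = 1/2` the claim is `(1 + e⁴)/2 ≤ 4e²`, which is numerically tight (about `27.8`
    -- against `29.6`).
    have h1 : Real.log (1 + 1 / 2 * m) ≤ Real.log (4 * Real.exp 2) := by
      refine Real.log_le_log (by positivity) ?_
      rw [hm, hexp4]
      nlinarith [hexp2.1, hexp2.2]
    rw [Real.log_mul (by norm_num) (by positivity), Real.log_exp,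
      show (4 : ℝ) = 2 ^ 2 by norm_num, Real.log_pow] at h1
    simp only [hf]
    rw [one_div, Real.log_inv, ← one_div]
    push_cast at h1
    linarith
  have := hconc.min_le_of_mem_Icc (by norm_num) (by norm_num) (Set.Ioo_subset_Icc_self hL)
  rw [hf1] at this
  have h3 : 0 ≤ f L := le_trans (le_min hf2 le_rfl) this
  simp only [hf] at h3
  linarith

/-- This is what an arm that was never pulled requires: its mixture equals `1` and its `sliceCost`
is `1`. -/
lemma two_mul_add_gGauss_nonneg {L : ℝ} (hL : L ∈ Set.Ioo (1 / 2 : ℝ) 1) :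
    0 ≤ 2 * L + gGauss L := by
  have h0 : 0 < L := by linarith [hL.1]
  have h1 : Real.log (4 * L) ≤ 2 := by
    have : Real.log (4 * L) ≤ Real.log (2 ^ 2) :=
      Real.log_le_log (by positivity) (by linarith [hL.2])
    rw [Real.log_pow] at this
    push_cast at this
    linarith [Real.log_two_lt_d9]
  have h2 : 0 ≤ Real.log (riemannZeta ((2 * L : ℝ) : ℂ)).re :=
    Real.log_nonneg (one_le_zeta_re (by linarith [hL.1]))
  have h3 : Real.log (1 - L) ≤ 0 := Real.log_nonpos (by linarith [hL.2]) (by linarith)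
  unfold gGauss
  nlinarith

/-- The mixture dominates the exponential of the compensated deviation of one arm. -/
lemma exp_le_mixRatio {L : ℝ} (hL : L ∈ Set.Ioo (1 / 2 : ℝ) 1) (n : ℕ) (S : ℝ)
    (hS : n = 0 → S = 0) :
    ENNReal.ofReal (Real.exp (L * (S ^ 2 / (2 * n) - 2 * sliceCost n) - gGauss L))
      ≤ mixRatio L n S := by
  have h0 : 0 < L := by linarith [hL.1]
  have h0' : 0 < 1 - L := by linarith [hL.2]
  rcases Nat.eq_zero_or_pos n with rfl | hn
  · rw [hS rfl, mixRatio_zero_zero hL, ← ENNReal.ofReal_one]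
    refine ENNReal.ofReal_le_ofReal (Real.exp_le_one_iff.2 ?_)
    have := two_mul_add_gGauss_nonneg hL
    simp only [sliceCost, if_true]
    simp
    linarith
  have hn1 : (1 : ℝ) ≤ n := by exact_mod_cast hn
  have hlog : 0 ≤ Real.log n := Real.log_nonneg hn1
  -- The index of the slice `e^{4i} ≤ n < e^{4(i+1)}`; the rest of the mixture is dropped.
  set i := ⌊Real.log n / 4⌋₊ with hi
  have hi1 : (i : ℝ) ≤ Real.log n / 4 := Nat.floor_le (by positivity)
  have hi2 : Real.log n / 4 < i + 1 := Nat.lt_floor_add_one _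
  refine le_trans ?_ (ENNReal.le_tsum i)
  refine ENNReal.ofReal_le_ofReal ?_
  set c : ℝ := Real.exp (4 * i) with hc
  have hc0 : 0 < c := Real.exp_pos _
  have hcn : c ≤ n := by
    rw [hc, ← Real.le_log_iff_exp_le (by linarith)]
    linarith
  have hnc : (n : ℝ) ≤ c * Real.exp 4 := by
    rw [hc, ← Real.exp_add, ← Real.log_le_iff_le_exp (by linarith)]
    linarith
  have hκ : mixPrecision L i = c * ((1 - L) / L) := rfl
  have hz := one_le_zeta_re (p := 2 * L) (by linarith [hL.1])
  set Z := (riemannZeta ((2 * L : ℝ) : ℂ)).re with hZ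
  have hn0 : (0 : ℝ) < n := by linarith
  have hexp4 : (1 : ℝ) < Real.exp 4 := Real.one_lt_exp_iff.2 (by norm_num)
  have hq : mixPrecision L i / (n + mixPrecision L i)
      = c * (1 - L) / (L * n + c * (1 - L)) := by
    rw [hκ]; field_simp
  -- The worst case is the upper end `n = c e⁴` of the slice, where equality holds.
  have hq' : (1 - L) / (1 + L * (Real.exp 4 - 1)) ≤ mixPrecision L i / (n + mixPrecision L i) := by
    have hp : 0 < 1 + L * (Real.exp 4 - 1) := by nlinarith
    rw [hq, div_le_div_iff₀ hp (by positivity)]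
    have : L * n ≤ L * (c * Real.exp 4) := by gcongr
    nlinarith
  have hlogsqrt : 1 / 2 * Real.log (1 - L) - 1 / 2 * (4 * L - 4 * (L * Real.log L))
      ≤ Real.log √(mixPrecision L i / (n + mixPrecision L i)) := by
    have hp : 0 < 1 + L * (Real.exp 4 - 1) := by nlinarith
    have h1 := Real.log_le_log (by positivity) hq'
    rw [Real.log_div h0'.ne' hp.ne'] at h1
    have h2 := log_add_mul_exp_four_le hL
    rw [Real.log_sqrt (by have := mixPrecision_pos hL i; positivity)]
    linarith
  -- The precision `κ` is chosen so that `L (c + κ) = c`; hence `L (n + κ) ≤ n` from the lower end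
  -- `c` of the slice onwards.
  have hexpo : L * (S ^ 2 / (2 * n)) ≤ S ^ 2 / (2 * (n + mixPrecision L i)) := by
    have hpos := mixPrecision_pos hL i
    rw [← mul_div_assoc, div_le_div_iff₀ (by positivity) (by positivity)]
    have : L * (n + mixPrecision L i) ≤ n := by
      rw [hκ]
      have : L * (n + c * ((1 - L) / L)) = L * n + c * (1 - L) := by field_simp
      rw [this]
      nlinarith
    nlinarith [sq_nonneg S, mul_le_mul_of_nonneg_left this (sq_nonneg S)]
  have hslice : Real.log ((i : ℝ) + 1) ≤ Real.log (4 + Real.log n) - Real.log 4 := by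
    rw [← Real.log_div (by positivity) (by norm_num)]
    exact Real.log_le_log (by positivity) (by linarith)
  have hsqrt0 : 0 < √(mixPrecision L i / (n + mixPrecision L i)) := by
    have := mixPrecision_pos hL i
    positivity
  rw [← Real.le_log_iff_exp_le (by unfold mixWeight gaussRatio; positivity)]
  unfold mixWeight gaussRatio
  rw [Real.log_mul (by positivity) (by positivity), Real.log_mul hsqrt0.ne' (by positivity),
    Real.log_exp, Real.log_div (by positivity) (by positivity), Real.log_inv,
    Real.log_rpow (by positivity)]
  simp only [sliceCost, if_neg hn.ne', gGauss]
  rw [Real.log_mul (by norm_num) h0.ne']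
  have := mul_le_mul_of_nonneg_left hslice (by positivity : 0 ≤ 2 * L)
  linarith

/-- Concavity of `sliceCost`, through its tangent at the mean. -/
lemma sum_sliceCost_le {ι : Type*} [Fintype ι] (n : ι → ℕ) (t : ℕ) (hn : ∑ k, n k = t)
    (hι : 0 < Fintype.card ι) (ht : Fintype.card ι ≤ t) :
    ∑ k, sliceCost (n k)
      ≤ Fintype.card ι * Real.log (4 + Real.log ((t : ℝ) / Fintype.card ι)) := by
  have hK : (0 : ℝ) < Fintype.card ι := by exact_mod_cast hι
  have ht' : (Fintype.card ι : ℝ) ≤ t := by exact_mod_cast ht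
  set c : ℝ := (t : ℝ) / Fintype.card ι with hc
  have hc1 : 1 ≤ c := by rw [hc, le_div_iff₀ hK]; linarith
  have hlc : 0 ≤ Real.log c := Real.log_nonneg hc1
  set y := 4 + Real.log c with hy
  have hy4 : 4 ≤ y := by linarith
  -- The right side is the tangent at `c` of `x ↦ ln(4 + ln x)`; its linear part sums to zero
  -- because `c` is the mean count. At count `0` the value `1` fits because `1 ≤ ln 4 - 1/4`,
  -- whereas `ln 4` would fail for `y = 4`.
  have hpt : ∀ k, sliceCost (n k) ≤ Real.log y + (n k / c - 1) / y := by
    intro k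
    unfold sliceCost
    split_ifs with h
    · rw [h]
      have h1 : Real.log 4 ≤ Real.log y := Real.log_le_log (by norm_num) hy4
      rw [show (4 : ℝ) = 2 ^ 2 by norm_num, Real.log_pow] at h1
      have h2 : 1 / y ≤ 1 / 4 := one_div_le_one_div_of_le (by norm_num) hy4
      have h3 := Real.log_two_gt_d9
      push_cast at h1
      simp only [Nat.cast_zero, zero_div, zero_sub, neg_div]
      linarith
    · have hn1 : (1 : ℝ) ≤ n k := by exact_mod_cast Nat.one_le_iff_ne_zero.2 h
      have hl : 0 ≤ Real.log (n k) := Real.log_nonneg hn1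
      have h1 := Real.log_le_sub_one_of_pos (x := (4 + Real.log (n k)) / y) (by positivity)
      rw [Real.log_div (by positivity) (by positivity)] at h1
      have h2 := Real.log_le_sub_one_of_pos (x := n k / c) (by positivity)
      rw [Real.log_div (by positivity) (by positivity)] at h2
      have h3 : (4 + Real.log (n k)) / y - 1 = (Real.log (n k) - Real.log c) / y := by
        field_simp; rw [hy]; ring
      have h4 : (Real.log (n k) - Real.log c) / y ≤ (n k / c - 1) / y := by gcongr
      linarith
  refine (Finset.sum_le_sum fun k _ => hpt k).trans (le_of_eq ?_)
  rw [Finset.sum_add_distrib, ← Finset.sum_div, Finset.sum_sub_distrib, ← Finset.sum_div,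
    ← Nat.cast_sum, hn]
  simp only [Finset.sum_const, Finset.card_univ, nsmul_eq_mul, mul_one]
  have : (t : ℝ) / c = Fintype.card ι := by
    have : (t : ℝ) ≠ 0 := by linarith
    rw [hc]; field_simp
  rw [this]
  simp

/-! ### Measurability, integration against independent noise, Ville's inequality. -/

lemma measurable_of_apply {α ι β : Type*} {m : MeasurableSpace α} [MeasurableSpace β]
    {f : α → ι → β} (h : ∀ i, Measurable fun x => f x i) : Measurable f :=
  measurable_pi_lambda _ h

lemma measurable_mixRatio_comp {α : Type*} {m : MeasurableSpace α} (L : ℝ) {f : α → ℕ} {g : α → ℝ}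
    (hf : Measurable f) (hg : Measurable g) : Measurable fun x => mixRatio L (f x) (g x) := by
  have h := (measurable_mixRatio L).comp (hf.prodMk hg)
  exact h

lemma measurable_indicator_one {α : Type*} {m : MeasurableSpace α} {E : Set α}
    (hE : MeasurableSet E) : Measurable (E.indicator (1 : α → ENNReal)) :=
  measurable_one.indicator hE

/-- Fubini for a function of the past and of a variable that is independent of the past. -/
lemma lintegral_of_indep {Ω β : Type*} {m mΩ : MeasurableSpace Ω} [MeasurableSpace β]
    {P : Measure Ω} [IsProbabilityMeasure P] (hm : m ≤ mΩ) {Y : Ω → β} (hY : Measurable[m] Y)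
    {η : Ω → ℝ} (hη : Measurable η) (hind : Indep (MeasurableSpace.comap η inferInstance) m P)
    {φ : β × ℝ → ENNReal} (hφ : Measurable φ) :
    ∫⁻ ω, φ (Y ω, η ω) ∂P = ∫⁻ ω, ∫⁻ x, φ (Y ω, x) ∂(P.map η) ∂P := by
  have hY' : Measurable Y := hY.mono hm le_rfl
  have hYη : IndepFun Y η P :=
    (IndepFun_iff_Indep _ _ _).2 (indep_of_indep_of_le_left hind.symm hY.comap_le)
  have := Measure.isProbabilityMeasure_map (μ := P) hη.aemeasurable
  have hmap := (indepFun_iff_map_prod_eq_prod_map_map hY'.aemeasurable hη.aemeasurable).1 hYη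
  calc ∫⁻ ω, φ (Y ω, η ω) ∂P = ∫⁻ q, φ q ∂(P.map (fun ω => (Y ω, η ω))) :=
        (lintegral_map hφ (hY'.prodMk hη)).symm
    _ = ∫⁻ y, ∫⁻ x, φ (y, x) ∂(P.map η) ∂(P.map Y) := by
        rw [hmap, lintegral_prod _ hφ.aemeasurable]
    _ = _ := lintegral_map hφ.lintegral_prod_right' hY'

/-- Ville's inequality for a non-negative supermartingale. -/
lemma measure_exists_le_of_supermartingale {Ω : Type*} {mΩ : MeasurableSpace Ω}
    {P : Measure Ω} {𝓖 : Filtration ℕ mΩ} {W : ℕ → Ω → ENNReal}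
    (hW : ∀ t, Measurable[𝓖 t] (W t))
    (hstep : ∀ t, ∀ E, MeasurableSet[𝓖 t] E → ∫⁻ ω in E, W (t + 1) ω ∂P ≤ ∫⁻ ω in E, W t ω ∂P)
    (c : ENNReal) :
    c * P {ω | ∃ t, c ≤ W t ω} ≤ ∫⁻ ω, W 0 ω ∂P := by
  set B : ℕ → Set Ω := fun n => {ω | ∃ t ≤ n, c ≤ W t ω} with hB
  have hlevel : ∀ t, MeasurableSet[𝓖 t] {ω | c ≤ W t ω} := fun t => hW t measurableSet_Ici
  have hBm : ∀ n, MeasurableSet[𝓖 n] (B n) := by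
    intro n
    have : B n = ⋃ t ∈ Set.Iic n, {ω | c ≤ W t ω} := by ext; simp [hB]
    rw [this]
    exact MeasurableSet.biUnion (Set.to_countable _) fun t ht =>
      𝓖.mono (show t ≤ n from ht) _ (hlevel t)
  have hBs : ∀ n, B (n + 1) = B n ∪ {ω | c ≤ W (n + 1) ω} := by
    intro n
    ext ω
    simp only [hB, Set.mem_ofPred_eq, Set.mem_union]
    constructor
    · rintro ⟨t, ht, h⟩
      rcases Nat.lt_or_ge n t with h' | h'
      · obtain rfl : t = n + 1 := by omega
        exact Or.inr h
      · exact Or.inl ⟨t, h', h⟩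
    · rintro (⟨t, ht, h⟩ | h)
      · exact ⟨t, by omega, h⟩
      · exact ⟨n + 1, le_rfl, h⟩
  -- This is optional stopping at the first passage above `c`: paths that have crossed are frozen
  -- and count for `c`, the others carry their current value, and the total mass never increases.
  have hmain : ∀ n, c * P (B n) + ∫⁻ ω in (B n)ᶜ, W n ω ∂P ≤ ∫⁻ ω, W 0 ω ∂P := by
    intro n
    induction n with
    | zero =>
      have h0 : B 0 = {ω | c ≤ W 0 ω} := by ext; simp [hB]
      have hm0 := 𝓖.le 0 _ (hBm 0)
      rw [← lintegral_add_compl (μ := P) (W 0) hm0]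
      refine add_le_add ?_ le_rfl
      calc c * P (B 0) = ∫⁻ _ in B 0, c ∂P := (setLIntegral_const _ _).symm
        _ ≤ _ := setLIntegral_mono' hm0 fun ω hω => by rw [h0] at hω; exact hω
    | succ n ih =>
      refine le_trans ?_ ih
      have hm := 𝓖.le n _ (hBm n)
      have hm1 := 𝓖.le (n + 1) _ (hBm (n + 1))
      have hsub : B n ⊆ B (n + 1) := by rw [hBs]; exact Set.subset_union_left
      set D := B (n + 1) \ B n with hD
      have hDm : MeasurableSet D := hm1.diff hm
      have hsplit : (B n)ᶜ = D ∪ (B (n + 1))ᶜ := by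
        ext ω
        have := @hsub ω
        simp only [hD, Set.mem_compl_iff, Set.mem_union, Set.mem_sdiff]
        tauto
      have hdisj : Disjoint D (B (n + 1))ᶜ :=
        Set.disjoint_left.2 fun ω h1 h2 => h2 h1.1
      have hP : P (B (n + 1)) = P (B n) + P D := by
        rw [hD, ← measure_union Set.disjoint_sdiff_right hDm, Set.union_sdiff_cancel hsub]
      have h1 := hstep n _ (hBm n).compl
      rw [hsplit, lintegral_union hm1.compl hdisj, ← hsplit] at h1
      have h2 : c * P D ≤ ∫⁻ ω in D, W (n + 1) ω ∂P :=
        calc c * P D = ∫⁻ _ in D, c ∂P := (setLIntegral_const _ _).symm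
          _ ≤ _ := setLIntegral_mono' hDm fun ω hω => by
            have := hω.1
            rw [hBs] at this
            exact this.resolve_left hω.2
      calc c * P (B (n + 1)) + ∫⁻ ω in (B (n + 1))ᶜ, W (n + 1) ω ∂P
          = c * P (B n) + (c * P D + ∫⁻ ω in (B (n + 1))ᶜ, W (n + 1) ω ∂P) := by
            rw [hP, mul_add, add_assoc]
        _ ≤ c * P (B n) + ∫⁻ ω in (B n)ᶜ, W n ω ∂P := by
            gcongr
            exact le_trans (by gcongr) h1
  have hunion : {ω | ∃ t, c ≤ W t ω} = ⋃ n, B n := by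
    ext ω
    simp only [hB, Set.mem_ofPred_eq, Set.mem_iUnion]
    exact ⟨fun ⟨t, h⟩ => ⟨t, t, le_rfl, h⟩, fun ⟨n, t, _, h⟩ => ⟨t, h⟩⟩
  have hmono : Monotone B := fun m n hmn ω ⟨t, ht, h⟩ => ⟨t, ht.trans hmn, h⟩
  rw [hunion, hmono.measure_iUnion, ENNReal.mul_iSup]
  exact iSup_le fun n => le_self_add.trans (hmain n)

/-! ### Counts and noise sums of the arms; the product martingale. -/

section Bandit

variable {d : ℕ} {𝒦 : Finset (Fin d → ℝ)} {Ω : Type*}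

open scoped Classical in
/-- The sum of the noise in the observations of the arm `k` during the rounds `1, …, t`. -/
noncomputable def noiseSum (a : ℕ → Ω → 𝒦) (X : ℕ → Ω → ℝ) (μ : Fin d → ℝ) (t : ℕ) (ω : Ω)
    (k : 𝒦) : ℝ :=
  ∑ s ∈ (Finset.Icc 1 t).filter (fun s => a s ω = k), (X s ω - μ ⬝ᵥ (a s ω : Fin d → ℝ))

open scoped Classical in
lemma pullCount_succ (a : ℕ → Ω → 𝒦) (t : ℕ) (ω : Ω) (k : 𝒦) :
    pullCount a (t + 1) ω k = pullCount a t ω k + if a (t + 1) ω = k then 1 else 0 := by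
  unfold pullCount
  rw [← Finset.insert_Icc_right_eq_Icc_add_one (by omega), Finset.filter_insert]
  split_ifs with h
  · rw [Finset.card_insert_of_notMem (by simp)]
  · simp

open scoped Classical in
lemma noiseSum_succ (a : ℕ → Ω → 𝒦) (X : ℕ → Ω → ℝ) (μ : Fin d → ℝ) (t : ℕ) (ω : Ω) (k : 𝒦) :
    noiseSum a X μ (t + 1) ω k = noiseSum a X μ t ω k +
      if a (t + 1) ω = k then X (t + 1) ω - μ ⬝ᵥ (a (t + 1) ω : Fin d → ℝ) else 0 := by
  unfold noiseSum
  rw [← Finset.insert_Icc_right_eq_Icc_add_one (by omega), Finset.filter_insert]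
  split_ifs with h
  · rw [Finset.sum_insert (by simp), add_comm]
  · simp

@[simp] lemma pullCount_zero (a : ℕ → Ω → 𝒦) (ω : Ω) (k : 𝒦) : pullCount a 0 ω k = 0 := by
  simp [pullCount]

@[simp] lemma noiseSum_zero (a : ℕ → Ω → 𝒦) (X : ℕ → Ω → ℝ) (μ : Fin d → ℝ) (ω : Ω) (k : 𝒦) :
    noiseSum a X μ 0 ω k = 0 := by
  simp [noiseSum]

lemma noiseSum_eq_zero (a : ℕ → Ω → 𝒦) (X : ℕ → Ω → ℝ) (μ : Fin d → ℝ) (t : ℕ) (ω : Ω) (k : 𝒦)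
    (h : pullCount a t ω k = 0) : noiseSum a X μ t ω k = 0 := by
  classical
  unfold pullCount at h
  rw [Finset.card_eq_zero] at h
  unfold noiseSum
  rw [h, Finset.sum_empty]

lemma sum_pullCount (a : ℕ → Ω → 𝒦) (t : ℕ) (ω : Ω) : ∑ k, pullCount a t ω k = t := by
  classical
  induction t with
  | zero => simp
  | succ t ih =>
    rw [Finset.sum_congr rfl fun k _ => pullCount_succ a t ω k, Finset.sum_add_distrib, ih]
    simp

variable {mΩ : MeasurableSpace Ω} {𝓖 : Filtration ℕ mΩ} {a : ℕ → Ω → 𝒦} {X : ℕ → Ω → ℝ}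

lemma IsSamplingRule.measurable_noise (h : IsSamplingRule 𝓖 a X) (μ : Fin d → ℝ) (t : ℕ) :
    Measurable[𝓖 (t + 1)] (fun ω => X (t + 1) ω - μ ⬝ᵥ (a (t + 1) ω : Fin d → ℝ)) := by
  have h1 : Measurable[𝓖 (t + 1)] (a (t + 1)) :=
    (h.arm_measurable t).mono (𝓖.mono (Nat.le_succ t)) le_rfl
  refine Measurable.sub (h.obs_measurable t) ?_
  have : Measurable (fun k : 𝒦 => μ ⬝ᵥ (k : Fin d → ℝ)) := measurable_of_finite _
  exact this.comp h1

lemma IsSamplingRule.measurable_pullCount (h : IsSamplingRule 𝓖 a X) (t : ℕ) :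
    Measurable[𝓖 t] (pullCount a t) := by
  classical
  refine measurable_of_apply fun k => ?_
  induction t with
  | zero => simp
  | succ t ih =>
    simp only [pullCount_succ]
    have hle := 𝓖.mono (Nat.le_succ t)
    refine Measurable.add (ih.mono hle le_rfl) ?_
    have : Measurable (fun j : 𝒦 => if j = k then 1 else 0) := measurable_of_finite _
    exact this.comp ((h.arm_measurable t).mono hle le_rfl)

lemma IsSamplingRule.measurable_noiseSum (h : IsSamplingRule 𝓖 a X) (μ : Fin d → ℝ) (t : ℕ) :
    Measurable[𝓖 t] (noiseSum a X μ t) := by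
  classical
  refine measurable_of_apply fun k => ?_
  induction t with
  | zero => simp
  | succ t ih =>
    simp only [noiseSum_succ]
    have hle := 𝓖.mono (Nat.le_succ t)
    refine Measurable.add (ih.mono hle le_rfl) ?_
    refine Measurable.ite ?_ (h.measurable_noise μ t) measurable_const
    exact ((h.arm_measurable t).mono hle le_rfl) (measurableSet_singleton k)

/-- The product over the arms of the mixtures of likelihood ratios. -/
noncomputable def mixWealth (L : ℝ) (a : ℕ → Ω → 𝒦) (X : ℕ → Ω → ℝ) (μ : Fin d → ℝ) (t : ℕ)
    (ω : Ω) : ENNReal :=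
  ∏ k, mixRatio L (pullCount a t ω k) (noiseSum a X μ t ω k)

lemma IsSamplingRule.measurable_mixWealth (h : IsSamplingRule 𝓖 a X) (L : ℝ) (μ : Fin d → ℝ)
    (t : ℕ) : Measurable[𝓖 t] (mixWealth L a X μ t) := by
  have : Measurable (fun q : (𝒦 → ℕ) × (𝒦 → ℝ) => ∏ k, mixRatio L (q.1 k) (q.2 k)) :=
    Finset.measurable_prod _ fun k _ => measurable_mixRatio_comp L (by fun_prop) (by fun_prop)
  have hcomp := this.comp ((h.measurable_pullCount t).prodMk (h.measurable_noiseSum μ t))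
  exact hcomp

/-- The next arm is known from the past and the noise is a standard Gaussian independent of it, so
only the factor of that arm moves and its conditional mean is unchanged. Equality on every past
event `E` is the martingale property. -/
lemma setLIntegral_mixWealth_succ {L : ℝ} (hL : L ∈ Set.Ioo (1 / 2 : ℝ) 1)
    (h : IsSamplingRule 𝓖 a X) {μ : Fin d → ℝ} {P : Measure Ω} (hP : IsGaussianBandit 𝓖 a X μ P)
    (t : ℕ) (E : Set Ω) (hE : MeasurableSet[𝓖 t] E) :
    ∫⁻ ω in E, mixWealth L a X μ (t + 1) ω ∂P = ∫⁻ ω in E, mixWealth L a X μ t ω ∂P := by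
  classical
  have := hP.isProbabilityMeasure
  set φ : ((𝒦 → ℕ) × (𝒦 → ℝ) × 𝒦 × ENNReal) × ℝ → ENNReal := fun q =>
    q.1.2.2.2 * ∏ k, mixRatio L (q.1.1 k + if q.1.2.2.1 = k then 1 else 0)
      (q.1.2.1 k + if q.1.2.2.1 = k then q.2 else 0) with hφ
  have hφm : Measurable φ := by
    refine Measurable.mul (by fun_prop) (Finset.measurable_prod _ fun k _ => ?_)
    have hs : MeasurableSet {q : ((𝒦 → ℕ) × (𝒦 → ℝ) × 𝒦 × ENNReal) × ℝ | q.1.2.2.1 = k} :=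
      (show Measurable (fun q : ((𝒦 → ℕ) × (𝒦 → ℝ) × 𝒦 × ENNReal) × ℝ => q.1.2.2.1) by fun_prop)
        (measurableSet_singleton k)
    refine measurable_mixRatio_comp L ?_ ?_
    · exact Measurable.add (by fun_prop) (Measurable.ite hs measurable_const measurable_const)
    · exact Measurable.add (by fun_prop) (Measurable.ite hs measurable_snd measurable_const)
  -- The indicator of `E` is carried as part of the past, so that the integral over `E` becomes one
  -- over `Ω`.
  set Y : Ω → (𝒦 → ℕ) × (𝒦 → ℝ) × 𝒦 × ENNReal := fun ω =>
    (pullCount a t ω, noiseSum a X μ t ω, a (t + 1) ω, E.indicator 1 ω) with hYdef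
  have hY : Measurable[𝓖 t] Y :=
    (h.measurable_pullCount t).prodMk ((h.measurable_noiseSum μ t).prodMk
      ((h.arm_measurable t).prodMk (measurable_indicator_one hE)))
  have key := lintegral_of_indep (𝓖.le t) hY ((h.measurable_noise μ t).mono (𝓖.le _) le_rfl)
    (hP.noise_indep t) hφm
  rw [hP.noise_law t] at key
  have hE' := 𝓖.le t _ hE
  rw [← lintegral_indicator hE', ← lintegral_indicator hE']
  convert key using 2
  · ext ω
    have hsucc : mixWealth L a X μ (t + 1) ω = ∏ k,
        mixRatio L (pullCount a t ω k + if a (t + 1) ω = k then 1 else 0)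
          (noiseSum a X μ t ω k +
            if a (t + 1) ω = k then X (t + 1) ω - μ ⬝ᵥ (a (t + 1) ω : Fin d → ℝ) else 0) :=
      Finset.prod_congr rfl fun k _ => by rw [pullCount_succ, noiseSum_succ]
    simp only [hφ, hYdef, Set.indicator_apply, hsucc]
    split_ifs <;> simp
  · ext ω
    simp only [hφ, hYdef]
    rw [lintegral_const_mul _ (Finset.measurable_prod _ fun k _ => ?_)]
    · have : ∀ x : ℝ, ∏ k, mixRatio L (pullCount a t ω k + if a (t + 1) ω = k then 1 else 0)
          (noiseSum a X μ t ω k + if a (t + 1) ω = k then x else 0)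
          = mixRatio L (pullCount a t ω (a (t + 1) ω) + 1) (noiseSum a X μ t ω (a (t + 1) ω) + x) *
            ∏ k ∈ Finset.univ.erase (a (t + 1) ω),
              mixRatio L (pullCount a t ω k) (noiseSum a X μ t ω k) := by
        intro x
        rw [← Finset.mul_prod_erase _ _ (Finset.mem_univ (a (t + 1) ω))]
        congr 1
        · simp
        · refine Finset.prod_congr rfl fun k hk => ?_
          have : a (t + 1) ω ≠ k := (Finset.ne_of_mem_erase hk).symm
          simp [this]
      simp_rw [this]
      have hm : Measurable fun x => mixRatio L (pullCount a t ω (a (t + 1) ω) + 1)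
          (noiseSum a X μ t ω (a (t + 1) ω) + x) :=
        measurable_mixRatio_comp L measurable_const (measurable_const.add measurable_id)
      rw [lintegral_mul_const _ hm, lintegral_mixRatio hL,
        Finset.mul_prod_erase _ (fun k => mixRatio L (pullCount a t ω k) (noiseSum a X μ t ω k))
          (Finset.mem_univ _)]
      by_cases hω : ω ∈ E <;> simp [hω, mixWealth]
    · refine measurable_mixRatio_comp L
        (f := fun _ => pullCount a t ω k + if a (t + 1) ω = k then 1 else 0)
        measurable_const (measurable_const.add ?_)
      split_ifs
      exacts [measurable_id, measurable_const]

/-! ### Time-uniform deviation inequalities. -/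

/-- The total deviation of the empirical means of the arms. -/
noncomputable def totalDeviation (a : ℕ → Ω → 𝒦) (X : ℕ → Ω → ℝ) (μ : Fin d → ℝ) (t : ℕ)
    (ω : Ω) : ℝ :=
  ∑ k, noiseSum a X μ t ω k ^ 2 / (2 * pullCount a t ω k)

lemma exp_le_mixWealth {L : ℝ} (hL : L ∈ Set.Ioo (1 / 2 : ℝ) 1) (a : ℕ → Ω → 𝒦) (X : ℕ → Ω → ℝ)
    (μ : Fin d → ℝ) (t : ℕ) (ω : Ω) :
    ENNReal.ofReal (Real.exp (L * (totalDeviation a X μ t ω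
      - 2 * ∑ k, sliceCost (pullCount a t ω k)) - 𝒦.card * gGauss L))
      ≤ mixWealth L a X μ t ω := by
  have : L * (totalDeviation a X μ t ω - 2 * ∑ k, sliceCost (pullCount a t ω k))
      - 𝒦.card * gGauss L = ∑ k : 𝒦, (L * (noiseSum a X μ t ω k ^ 2 / (2 * pullCount a t ω k)
        - 2 * sliceCost (pullCount a t ω k)) - gGauss L) := by
    rw [Finset.sum_sub_distrib, ← Finset.mul_sum, Finset.sum_sub_distrib, ← Finset.mul_sum]
    simp [totalDeviation]
  rw [this, Real.exp_sum, ENNReal.ofReal_prod_of_nonneg fun _ _ => (Real.exp_pos _).le]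
  exact Finset.prod_le_prod' fun k _ => exp_le_mixRatio hL _ _ (noiseSum_eq_zero a X μ t ω k)

/-- Time-uniform deviation inequality, for a single value of the parameter of the mixture. -/
lemma measure_totalDeviation_gt_le {L : ℝ} (hL : L ∈ Set.Ioo (1 / 2 : ℝ) 1)
    (h : IsSamplingRule 𝓖 a X) {μ : Fin d → ℝ} {P : Measure Ω} (hP : IsGaussianBandit 𝓖 a X μ P)
    (hK : 0 < 𝒦.card) {δ : ℝ} (hδ : 0 < δ) :
    P {ω | ∃ t, 𝒦.card ≤ t ∧ 2 * 𝒦.card * Real.log (4 + Real.log ((t : ℝ) / 𝒦.card))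
        + 𝒦.card * ((gGauss L + Real.log (1 / δ) / 𝒦.card) / L) < totalDeviation a X μ t ω}
      ≤ ENNReal.ofReal δ := by
  have := hP.isProbabilityMeasure
  have hL0 : 0 < L := by linarith [hL.1]
  have hK' : (0 : ℝ) < 𝒦.card := by exact_mod_cast hK
  have hville := measure_exists_le_of_supermartingale (h.measurable_mixWealth L μ)
    (fun t E hE => (setLIntegral_mixWealth_succ hL h hP t E hE).le) (ENNReal.ofReal (1 / δ))
  have h0 : ∫⁻ ω, mixWealth L a X μ 0 ω ∂P = 1 := by
    simp [mixWealth, mixRatio_zero_zero hL]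
  rw [h0] at hville
  have hsub : {ω | ∃ t, 𝒦.card ≤ t ∧ 2 * 𝒦.card * Real.log (4 + Real.log ((t : ℝ) / 𝒦.card))
        + 𝒦.card * ((gGauss L + Real.log (1 / δ) / 𝒦.card) / L) < totalDeviation a X μ t ω}
      ⊆ {ω | ∃ t, ENNReal.ofReal (1 / δ) ≤ mixWealth L a X μ t ω} := by
    rintro ω ⟨t, ht, hlt⟩
    refine ⟨t, le_trans ?_ (exp_le_mixWealth hL a X μ t ω)⟩
    refine ENNReal.ofReal_le_ofReal ?_
    rw [← Real.log_le_iff_le_exp (by positivity)]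
    have hsum := sum_sliceCost_le (pullCount a t ω) t (sum_pullCount a t ω)
      (by simpa using hK) (by simpa using ht)
    simp only [Fintype.card_coe] at hsum
    have h1 : 𝒦.card * ((gGauss L + Real.log (1 / δ) / 𝒦.card) / L)
        ≤ totalDeviation a X μ t ω - 2 * ∑ k, sliceCost (pullCount a t ω k) := by linarith
    have h2 := mul_le_mul_of_nonneg_left h1 hL0.le
    have h3 : L * (𝒦.card * ((gGauss L + Real.log (1 / δ) / 𝒦.card) / L))
        = 𝒦.card * gGauss L + Real.log (1 / δ) := by field_simp
    linarith
  have hδ' : ENNReal.ofReal (1 / δ) ≠ 0 := by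
    rw [Ne, ENNReal.ofReal_eq_zero, not_le]; positivity
  calc _ ≤ P {ω | ∃ t, ENNReal.ofReal (1 / δ) ≤ mixWealth L a X μ t ω} := measure_mono hsub
    _ ≤ 1 / ENNReal.ofReal (1 / δ) := by
        rw [ENNReal.le_div_iff_mul_le (Or.inl hδ') (Or.inl ENNReal.ofReal_ne_top), mul_comm]
        exact hville
    _ = _ := by
        rw [one_div, one_div, ENNReal.ofReal_inv_of_pos hδ, inv_inv]

/-- Time-uniform deviation inequality with the threshold `stopThreshold`. -/
lemma measure_stopThreshold_lt_le (h : IsSamplingRule 𝓖 a X) {μ : Fin d → ℝ} {P : Measure Ω}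
    (hP : IsGaussianBandit 𝓖 a X μ P) (hK : 0 < 𝒦.card) {δ : ℝ} (hδ : 0 < δ) :
    P {ω | ∃ t, 𝒦.card ≤ t ∧ stopThreshold 𝒦.card t δ < totalDeviation a X μ t ω}
      ≤ ENNReal.ofReal δ := by
  have hK' : (0 : ℝ) < 𝒦.card := by exact_mod_cast hK
  set x := Real.log (1 / δ) / 𝒦.card with hx
  -- Each slack `1/(n+1)` above the infimum allows a single deterministic `L`. The events increase
  -- with `n` and each has probability at most `δ`, so their union does too, without a union bound
  -- over `L`.
  set B : ℕ → Set Ω := fun n => {ω | ∃ t, 𝒦.card ≤ t ∧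
    stopThreshold 𝒦.card t δ + 𝒦.card * (1 / ((n : ℝ) + 1)) < totalDeviation a X μ t ω} with hB
  have hunion : {ω | ∃ t, 𝒦.card ≤ t ∧ stopThreshold 𝒦.card t δ < totalDeviation a X μ t ω}
      ⊆ ⋃ n, B n := by
    rintro ω ⟨t, ht, hlt⟩
    obtain ⟨n, hn⟩ := exists_nat_one_div_lt
      (div_pos (sub_pos.2 hlt) hK')
    rw [lt_div_iff₀ hK'] at hn
    exact Set.mem_iUnion.2 ⟨n, t, ht, by linarith⟩
  have hmono : Monotone B := by
    rintro m n hmn ω ⟨t, ht, hlt⟩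
    refine ⟨t, ht, lt_of_le_of_lt ?_ hlt⟩
    have := Nat.one_div_le_one_div (α := ℝ) hmn
    gcongr
  refine (measure_mono hunion).trans ?_
  rw [hmono.measure_iUnion]
  refine iSup_le fun n => ?_
  obtain ⟨_, ⟨L, hL, rfl⟩, hlt⟩ := exists_lt_of_csInf_lt
    (s := (fun lam : ℝ => (gGauss lam + x) / lam) '' Set.Ioo (1 / 2) 1)
    ((Set.nonempty_Ioo.2 (by norm_num)).image _)
    (lt_add_of_pos_right _ (Nat.one_div_pos_of_nat (α := ℝ) (n := n)))
  refine (measure_mono ?_).trans (measure_totalDeviation_gt_le hL h hP hK hδ)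
  rintro ω ⟨t, ht, hdev⟩
  refine ⟨t, ht, lt_trans ?_ hdev⟩
  have := mul_lt_mul_of_pos_left hlt hK'
  simp only at this
  rw [mul_add] at this
  unfold stopThreshold cGauss
  linarith

end Bandit

/-! ### Least squares: from the norm of the estimation error to the noise sums. -/

section Bandit

variable {d : ℕ} {𝒦 𝒵 : Finset (Fin d → ℝ)} {Ω : Type*} {mΩ : MeasurableSpace Ω}
  {𝓖 : Filtration ℕ mΩ} {a : ℕ → Ω → 𝒦} {X : ℕ → Ω → ℝ}

lemma designMatrix_mulVec (w : 𝒦 → ℝ) (v : Fin d → ℝ) :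
    designMatrix 𝒦 w *ᵥ v = ∑ k : 𝒦, (w k * ((k : Fin d → ℝ) ⬝ᵥ v)) • (k : Fin d → ℝ) := by
  unfold designMatrix
  rw [sum_mulVec]
  refine Finset.sum_congr rfl fun k _ => ?_
  rw [smul_mulVec, vecMulVec_mulVec, mul_smul]
  simp

lemma sqNorm_designMatrix (w : 𝒦 → ℝ) (v : Fin d → ℝ) :
    sqNorm (designMatrix 𝒦 w) v = ∑ k : 𝒦, w k * ((k : Fin d → ℝ) ⬝ᵥ v) ^ 2 := by
  unfold sqNorm
  rw [designMatrix_mulVec, dotProduct_sum]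
  refine Finset.sum_congr rfl fun k _ => ?_
  rw [dotProduct_smul, dotProduct_comm v, smul_eq_mul]
  ring

lemma sum_obs_smul_arm (a : ℕ → Ω → 𝒦) (X : ℕ → Ω → ℝ) (μ : Fin d → ℝ) (t : ℕ) (ω : Ω) :
    ∑ s ∈ Finset.Icc 1 t, X s ω • (a s ω : Fin d → ℝ)
      = empiricalDesign a t ω *ᵥ μ + ∑ k : 𝒦, noiseSum a X μ t ω k • (k : Fin d → ℝ) := by
  classical
  rw [empiricalDesign, designMatrix_mulVec]
  induction t with
  | zero => simp
  | succ t ih =>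
    rw [← Finset.insert_Icc_right_eq_Icc_add_one (by omega), Finset.sum_insert (by simp), ih]
    simp only [pullCount_succ, noiseSum_succ, Nat.cast_add, Nat.cast_ite, Nat.cast_one,
      Nat.cast_zero, add_mul, add_smul, Finset.sum_add_distrib, ite_mul, ite_smul, zero_mul,
      zero_smul, one_mul, Finset.sum_ite_eq, Finset.mem_univ, if_true]
    rw [dotProduct_comm μ, sub_smul]
    abel

/-- The self-normalized deviation of the least squares estimator is at most that of the empirical
means of the arms. -/
lemma sqNorm_ols_sub_le (a : ℕ → Ω → 𝒦) (X : ℕ → Ω → ℝ) (μ : Fin d → ℝ) (t : ℕ) (ω : Ω)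
    (hV : IsUnit (empiricalDesign a t ω).det) :
    sqNorm (empiricalDesign a t ω) (olsEstimator a X t ω - μ) ≤ 2 * totalDeviation a X μ t ω := by
  set V := empiricalDesign a t ω with hVdef
  set u := olsEstimator a X t ω - μ with hu
  have hVu : V *ᵥ u = ∑ k : 𝒦, noiseSum a X μ t ω k • (k : Fin d → ℝ) := by
    rw [hu, mulVec_sub, olsEstimator, mulVec_mulVec, ← hVdef, mul_nonsing_inv _ hV, one_mulVec,
      sum_obs_smul_arm a X μ t ω, ← hVdef, add_sub_cancel_left]
  have h1 : sqNorm V u = ∑ k : 𝒦, noiseSum a X μ t ω k * ((k : Fin d → ℝ) ⬝ᵥ u) := by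
    unfold sqNorm
    rw [hVu, dotProduct_sum]
    refine Finset.sum_congr rfl fun k _ => ?_
    rw [dotProduct_smul, dotProduct_comm, smul_eq_mul]
  have h2 : sqNorm V u = ∑ k : 𝒦, (pullCount a t ω k : ℝ) * ((k : Fin d → ℝ) ⬝ᵥ u) ^ 2 :=
    sqNorm_designMatrix _ u
  -- Writing the squared norm both as `∑ S_k x_k` and as `∑ N_k x_k²`, with `x_k = ⟨k, u⟩`, reduces
  -- the claim to `2 S x ≤ N x² + S²/N` for each arm.
  have h3 : 2 * sqNorm V u ≤ sqNorm V u + 2 * totalDeviation a X μ t ω := by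
    conv_lhs => rw [h1]
    rw [h2, totalDeviation, Finset.mul_sum, Finset.mul_sum, ← Finset.sum_add_distrib]
    refine Finset.sum_le_sum fun k _ => ?_
    rcases Nat.eq_zero_or_pos (pullCount a t ω k) with h0 | h0
    · simp [noiseSum_eq_zero a X μ t ω k h0, h0]
    · have hn : (0 : ℝ) < pullCount a t ω k := by exact_mod_cast h0
      have hsq := sq_nonneg ((pullCount a t ω k : ℝ) * ((k : Fin d → ℝ) ⬝ᵥ u)
        - noiseSum a X μ t ω k)
      rw [show 2 * (noiseSum a X μ t ω k ^ 2 / (2 * (pullCount a t ω k : ℝ)))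
        = noiseSum a X μ t ω k ^ 2 / pullCount a t ω k by field_simp, ← sub_nonneg]
      have : (pullCount a t ω k : ℝ) * ((k : Fin d → ℝ) ⬝ᵥ u) ^ 2
          + noiseSum a X μ t ω k ^ 2 / pullCount a t ω k
          - 2 * (noiseSum a X μ t ω k * ((k : Fin d → ℝ) ⬝ᵥ u))
          = ((pullCount a t ω k : ℝ) * ((k : Fin d → ℝ) ⬝ᵥ u) - noiseSum a X μ t ω k) ^ 2
            / pullCount a t ω k := by field_simp; ring
      rw [this]
      positivity
  linarith

/-! ### Measurability of the stopping rule and of the answer. -/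

lemma IsSamplingRule.measurable_sum_obs (h : IsSamplingRule 𝓖 a X) (t : ℕ) :
    Measurable[𝓖 t] (fun ω => ∑ s ∈ Finset.Icc 1 t, X s ω • (a s ω : Fin d → ℝ)) := by
  refine measurable_of_apply fun i => ?_
  simp only [Finset.sum_apply, Pi.smul_apply, smul_eq_mul]
  refine Finset.measurable_sum _ fun s hs => ?_
  obtain ⟨hs1, hs2⟩ := Finset.mem_Icc.1 hs
  obtain ⟨r, rfl⟩ : ∃ r, s = r + 1 := ⟨s - 1, by omega⟩
  have hX : Measurable[𝓖 t] (X (r + 1)) := (h.obs_measurable r).mono (𝓖.mono hs2) le_rfl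
  have ha : Measurable[𝓖 t] (a (r + 1)) := (h.arm_measurable r).mono (𝓖.mono (by omega)) le_rfl
  have hi : Measurable (fun k : 𝒦 => (k : Fin d → ℝ) i) := measurable_of_finite _
  exact Measurable.mul hX (hi.comp ha)

/-- The left-hand side of the stopping criterion is a measurable function of the statistics. -/
lemma measurable_iInf_sqNorm (C : Set (Fin d → ℝ)) :
    Measurable (fun q : (𝒦 → ℕ) × (Fin d → ℝ) => ⨅ lam ∈ C,
      ((sqNorm (designMatrix 𝒦 fun k => (q.1 k : ℝ))
        ((designMatrix 𝒦 fun k => (q.1 k : ℝ))⁻¹ *ᵥ q.2 - lam) : ℝ) : EReal)) := by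
  -- The counts take countably many values and can be fixed. The infimum may be uncountable, but an
  -- infimum of continuous functions is upper semicontinuous, hence measurable.
  refine measurable_from_prod_countable_right fun n => ?_
  refine UpperSemicontinuous.measurable ?_
  refine upperSemicontinuous_biInf fun lam _ => Continuous.upperSemicontinuous ?_
  refine continuous_coe_real_ereal.comp ?_
  have hu : Continuous fun y : Fin d → ℝ => (designMatrix 𝒦 fun k => (n k : ℝ))⁻¹ *ᵥ y - lam :=
    (continuous_const.matrix_mulVec continuous_id).sub continuous_const
  have hVu := (continuous_const (y := designMatrix 𝒦 fun k => (n k : ℝ))).matrix_mulVec hu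
  exact hu.dotProduct hVu

lemma measurableSet_stop (h : IsSamplingRule 𝓖 a X) (o : OptNotion) (ℳ : Set (Fin d → ℝ))
    (ε δ : ℝ) (𝒯 : Set ℕ) {z : ℕ → Ω → 𝒵} (hz : ∀ t, Measurable[𝓖 t] (z t)) (t : ℕ) :
    MeasurableSet[𝓖 t] {ω | Evaluated 𝒯 a t ω ∧ GLRCriterion o ℳ ε δ a X z t ω} := by
  have hle := 𝓖.mono (Nat.sub_le t 1)
  have hN : Measurable[𝓖 t] (pullCount a (t - 1)) := (h.measurable_pullCount (t - 1)).mono hle le_rfl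
  have hb := (h.measurable_sum_obs (t - 1)).mono hle le_rfl
  -- Splitting over the finitely many values of the candidate makes the alternative a fixed set on
  -- each piece.
  have hset : {ω | Evaluated 𝒯 a t ω ∧ GLRCriterion o ℳ ε δ a X z t ω}
      = (pullCount a (t - 1) ⁻¹' {n | t ∈ 𝒯 ∧ 𝒦.card < t ∧
          IsUnit (designMatrix 𝒦 fun k => (n k : ℝ)).det}) ∩
        ⋃ y : 𝒵, (z t ⁻¹' {y}) ∩
          ((fun ω => (pullCount a (t - 1) ω, ∑ s ∈ Finset.Icc 1 (t - 1),
            X s ω • (a s ω : Fin d → ℝ))) ⁻¹'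
          {q | ((2 * stopThreshold 𝒦.card (t - 1) δ : ℝ) : EReal) < ⨅ lam ∈ alternative o 𝒵 ℳ ε y,
            ((sqNorm (designMatrix 𝒦 fun k => (q.1 k : ℝ))
              ((designMatrix 𝒦 fun k => (q.1 k : ℝ))⁻¹ *ᵥ q.2 - lam) : ℝ) : EReal)}) := by
    ext ω
    simp only [Set.mem_ofPred_eq, Set.mem_inter_iff, Set.mem_preimage, Set.mem_iUnion,
      Set.mem_singleton_iff, exists_eq_left']
    rfl
  rw [hset]
  refine MeasurableSet.inter (hN (Set.to_countable _).measurableSet) ?_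
  refine MeasurableSet.iUnion fun y => MeasurableSet.inter (hz t (measurableSet_singleton y)) ?_
  exact (hN.prodMk hb) (measurableSet_lt measurable_const (measurable_iInf_sqNorm _))

lemma glrStop_le_iff (o : OptNotion) (ℳ : Set (Fin d → ℝ)) (ε δ : ℝ) (𝒯 : Set ℕ)
    (a : ℕ → Ω → 𝒦) (X : ℕ → Ω → ℝ) (z : ℕ → Ω → 𝒵) (ω : Ω) (t : ℕ) :
    glrStop o ℳ ε δ 𝒯 a X z ω ≤ t ↔
      ∃ s ≤ t, Evaluated 𝒯 a s ω ∧ GLRCriterion o ℳ ε δ a X z s ω := by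
  classical
  unfold glrStop
  split_ifs with h
  · rw [Nat.cast_le]
    convert! Nat.find_le_iff h t
  · refine iff_of_false (by simp) ?_
    exact fun ⟨s, _, hs⟩ => h ⟨s, hs⟩

lemma exists_of_glrStop_lt_top {o : OptNotion} {ℳ : Set (Fin d → ℝ)} {ε δ : ℝ} {𝒯 : Set ℕ}
    {z : ℕ → Ω → 𝒵} {ω : Ω} (h : glrStop o ℳ ε δ 𝒯 a X z ω < ⊤) :
    ∃ t, Evaluated 𝒯 a t ω ∧ GLRCriterion o ℳ ε δ a X z t ω ∧
      recommendedAt z (glrStop o ℳ ε δ 𝒯 a X z) ω = z t ω := by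
  classical
  have hex : ∃ t, Evaluated 𝒯 a t ω ∧ GLRCriterion o ℳ ε δ a X z t ω := by
    by_contra hne
    simp [glrStop, hne] at h
  refine ⟨Nat.find hex, (Nat.find_spec hex).1, (Nat.find_spec hex).2, ?_⟩
  unfold recommendedAt glrStop
  rw [dif_pos hex]
  rfl

lemma isStoppingTime_glrStop (h : IsSamplingRule 𝓖 a X) (o : OptNotion) (ℳ : Set (Fin d → ℝ))
    (ε δ : ℝ) (𝒯 : Set ℕ) {z : ℕ → Ω → 𝒵} (hz : ∀ t, Measurable[𝓖 t] (z t)) :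
    IsStoppingTime 𝓖 (glrStop o ℳ ε δ 𝒯 a X z) := by
  intro t
  have : {ω | glrStop o ℳ ε δ 𝒯 a X z ω ≤ t}
      = ⋃ s ∈ Set.Iic t, {ω | Evaluated 𝒯 a s ω ∧ GLRCriterion o ℳ ε δ a X z s ω} := by
    ext ω
    simp only [Set.mem_ofPred_eq, glrStop_le_iff, Set.mem_iUnion, Set.mem_Iic, exists_prop]
  change MeasurableSet[𝓖 t] {ω | glrStop o ℳ ε δ 𝒯 a X z ω ≤ ((t : ℕ) : WithTop ℕ)}
  rw [this]
  exact MeasurableSet.biUnion (Set.to_countable _) fun s hs =>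
    𝓖.mono (show s ≤ t from hs) _ (measurableSet_stop h o ℳ ε δ 𝒯 hz s)

lemma measurableSet_recommendedAt {τ : Ω → WithTop ℕ} (hτ : IsStoppingTime 𝓖 τ)
    {z : ℕ → Ω → 𝒵} (hz : ∀ t, Measurable[𝓖 t] (z t)) (y : 𝒵) (t : ℕ) :
    MeasurableSet[𝓖 t] {ω | τ ω ≤ (t : WithTop ℕ) ∧ recommendedAt z τ ω = y} := by
  have : {ω | τ ω ≤ (t : WithTop ℕ) ∧ recommendedAt z τ ω = y}
      = ⋃ s ∈ Set.Iic t, {ω | τ ω = (s : WithTop ℕ)} ∩ (z s ⁻¹' {y}) := by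
    ext ω
    simp only [Set.mem_ofPred_eq, Set.mem_iUnion, Set.mem_inter_iff, Set.mem_preimage,
      Set.mem_singleton_iff, Set.mem_Iic, exists_prop, recommendedAt]
    constructor
    · rintro ⟨hle, hy⟩
      obtain ⟨s, hs⟩ := WithTop.ne_top_iff_exists.1 (ne_top_of_le_ne_top WithTop.coe_ne_top hle)
      rw [← hs] at hle hy
      exact ⟨s, WithTop.coe_le_coe.1 hle, hs.symm, hy⟩
    · rintro ⟨s, hst, hs, hy⟩
      rw [hs]
      exact ⟨WithTop.coe_le_coe.2 hst, hy⟩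
  rw [this]
  refine MeasurableSet.biUnion (Set.to_countable _) fun s hs => ?_
  have hle : s ≤ t := hs
  exact MeasurableSet.inter (𝓖.mono hle _ (hτ.measurableSet_eq s))
    (𝓖.mono hle _ (hz s (measurableSet_singleton y)))

/-! ### Errors force a large deviation; conclusion. -/

/-- A true parameter for which the answer is wrong is one of the competitors in the infimum of the
criterion. -/
lemma stopThreshold_lt_totalDeviation {o : OptNotion} {ℳ : Set (Fin d → ℝ)} {ε δ : ℝ} {𝒯 : Set ℕ}
    {z : ℕ → Ω → 𝒵} {μ : Fin d → ℝ} (hμ : μ ∈ ℳ) {t : ℕ} {ω : Ω} (he : Evaluated 𝒯 a t ω)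
    (hc : GLRCriterion o ℳ ε δ a X z t ω) (hz : z t ω ∉ epsOptimal o 𝒵 ε μ) :
    stopThreshold 𝒦.card (t - 1) δ < totalDeviation a X μ (t - 1) ω := by
  have hmem : μ ∈ alternative o 𝒵 ℳ ε (z t ω) := subset_closure ⟨hμ, hz⟩
  have h1 := lt_of_lt_of_le hc (iInf₂_le μ hmem)
  rw [EReal.coe_lt_coe_iff] at h1
  linarith [sqNorm_ols_sub_le a X μ (t - 1) ω he.2.2]

end Bandit

theorem lemma3 {d : ℕ} (𝒦 𝒵 : Finset (Fin d → ℝ)) (h𝒵 : 𝒵.Nonempty)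
    (h𝒦 : Submodule.span ℝ (𝒦 : Set (Fin d → ℝ)) = ⊤)
    (ℳ : Set (Fin d → ℝ)) (o : OptNotion) (ε : ℝ) (hε : 0 ≤ ε) (δ : ℝ) (hδ : δ ∈ Set.Ioo (0 : ℝ) 1)
    (𝒯 : Set ℕ) (h𝒯 : 𝒯.Infinite)
    {Ω : Type*} {mΩ : MeasurableSpace Ω} (𝓖 : Filtration ℕ mΩ)
    (a : ℕ → Ω → 𝒦) (X : ℕ → Ω → ℝ) (haX : IsSamplingRule 𝓖 a X)
    (P : (Fin d → ℝ) → Measure Ω) (hP : ∀ μ ∈ ℳ, IsGaussianBandit 𝓖 a X μ (P μ))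
    (z : ℕ → Ω → 𝒵) (hz_meas : ∀ t, Measurable[𝓖 t] (z t))
    (hz : ∀ t ω, Evaluated 𝒯 a t ω →
      (epsOptimal o 𝒵 ε (olsEstimator a X (t - 1) ω)).Nonempty →
      z t ω ∈ epsOptimal o 𝒵 ε (olsEstimator a X (t - 1) ω)) :
    IsPACStrategy o ℳ ε δ 𝓖 P (glrStop o ℳ ε δ 𝒯 a X z)
      (recommendedAt z (glrStop o ℳ ε δ 𝒯 a X z)) where
  isStoppingTime := isStoppingTime_glrStop haX o ℳ ε δ 𝒯 hz_meas
  measurable_answer :=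
    measurableSet_recommendedAt (isStoppingTime_glrStop haX o ℳ ε δ 𝒯 hz_meas) hz_meas
  error_le μ hμ := by
    have := (hP μ hμ).isProbabilityMeasure
    -- A sample point exists and yields an arm, hence `K > 0`.
    obtain ⟨ω₀⟩ := (P μ).nonempty_of_neZero
    refine (measure_mono ?_).trans (measure_stopThreshold_lt_le haX (hP μ hμ)
      (Finset.card_pos.2 ⟨_, (a 0 ω₀).2⟩) hδ.1)
    rintro ω ⟨hτ, hne⟩
    obtain ⟨t, he, hc, hrec⟩ := exists_of_glrStop_lt_top hτ
    rw [hrec] at hne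
    -- The statistics are those after `t - 1` rounds, and `K < t` gives the `K ≤ t - 1` needed by
    -- the deviation inequality.
    exact ⟨t - 1, Nat.le_sub_one_of_lt he.2.1, stopThreshold_lt_totalDeviation hμ he hc hne⟩
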